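/- Let $V$ be a finite-dimensional complex vector space, and let $\mathcal F$ and $\overline{\mathcal F}$ be two complete decreasing filtrations of $V$ by complex subspaces, indexed by $\mathbb Z$ (complete: $\mathcal F^k=V$ for $k\ll 0$ and $\mathcal F^k=0$ for $k\gg 0$), which are conjugate with respect to a real structure $\mathfrak r$ on $V$, that is, $\overline{\mathcal F}^k=\mathfrak r(\mathcal F^k)$ for all $k$, where $\mathfrak r:V\to V$ is conjugate-linear. Let $B(V,\mathcal F)\subset \mathbb C[z,z^{-1}]\otimes_{\mathbb C}V$ be the $\mathbb C[z]$-submodule generated by the elements $z^{-k}v$ with $k\in\mathbb Z$ and $v\in\mathcal F^k$, and let $\mathcal S(V,\mathcal F)$ be the vector bundle on $\mathbb C$ whose module of sections is $B(V,\mathcal F)$; its restriction to $\mathbb C^*$ is the trivial bundle with fibre $V$. The Rees–Simpson bundle $\mathcal S(V,\mathcal F,\overline{\mathcal F})$ is the algebraic vector bundle on $\mathbb P^1$ obtained by gluing $\mathcal S(V,\mathcal F)$ and $\mathcal S(V,\overline{\mathcal F})$ over $\mathbb C^*$ by $(v,z)\mapsto(v,z^{-1})$. The slope of a nonzero vector bundle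 is its degree divided by its rank. A vector bundle $E$ on $\mathbb P^1$ is semistable if no nonzero coherent subsheaf of $E$ has slope larger than that of $E$; the zero bundle counts as semistable of every slope. Proposition. For every integer $w$, the filtrations $\mathcal F$ and $\overline{\mathcal F}$ define a decomposition of $V$ that is pure of weight $w$, i.e. $$V=\bigoplus_{k+m=w}V^{k,m},\qquad V^{k,m}=\mathcal F^k\cap\overline{\mathcal F}^m,$$ if and only if the bundle $\mathcal S(V,\mathcal F,\overline{\mathcal F})$ is semistable of slope $w$. -/

import Mathlib

open scoped TensorProduct Polynomial LaurentPolynomial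

noncomputable section

universe u

/-! ### Algebraic vector bundles on the complex projective line

The projective line is covered by two copies of the affine line, with coordinates `z` and `w`,
glued along the complement of the origin by `z ↦ w = 1 / z`.  The coordinate ring of each copy is
`ℂ[X]`, that of the punctured line is `ℂ[T;T⁻¹]`, and the gluing is the substitution `T ↦ T⁻¹`. -/

/-- The substitution `T ↦ T⁻¹` on the coordinate ring of the punctured line. -/
def coordInv : ℂ[T;T⁻¹] →+* ℂ[T;T⁻¹] :=
  (LaurentPolynomial.invert (R := ℂ) : ℂ[T;T⁻¹] ≃ₐ[ℂ] ℂ[T;T⁻¹]).toRingEquiv.toRingHom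

theorem coordInv_apply (f : ℂ[T;T⁻¹]) : coordInv f = LaurentPolynomial.invert f := rfl

theorem coordInv_coordInv (f : ℂ[T;T⁻¹]) : coordInv (coordInv f) = f :=
  LaurentPolynomial.involutive_invert f

instance coordInv_invPair : RingHomInvPair coordInv coordInv where
  comp_eq := RingHom.ext coordInv_coordInv
  comp_eq₂ := RingHom.ext coordInv_coordInv

/-- An algebraic vector bundle on the projective line: a vector bundle on each of the two affine
charts, that is, the finitely generated projective `ℂ[X]`-module of its sections, together with an
isomorphism of the restrictions to the punctured line, which covers the gluing `z ↦ 1 / z`. -/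
structure P1Bundle where
  /-- Sections over the chart with coordinate `z`, around the point `0`. -/
  M₀ : Type u
  /-- Sections over the chart with coordinate `w = 1 / z`, around the point `∞`. -/
  M₁ : Type u
  [addCommGroup₀ : AddCommGroup M₀]
  [addCommGroup₁ : AddCommGroup M₁]
  [module₀ : Module ℂ[X] M₀]
  [module₁ : Module ℂ[X] M₁]
  [finite₀ : Module.Finite ℂ[X] M₀]
  [finite₁ : Module.Finite ℂ[X] M₁]
  [projective₀ : Module.Projective ℂ[X] M₀]
  [projective₁ : Module.Projective ℂ[X] M₁]
  /-- The gluing isomorphism over the punctured line. -/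
  glue : (ℂ[T;T⁻¹] ⊗[ℂ[X]] M₀) ≃ₛₗ[coordInv] (ℂ[T;T⁻¹] ⊗[ℂ[X]] M₁)

namespace P1Bundle

attribute [instance] addCommGroup₀ addCommGroup₁ module₀ module₁ finite₀ finite₁
  projective₀ projective₁

/-- The rank of a vector bundle. -/
def rank (E : P1Bundle.{u}) : ℕ := Module.finrank ℂ[X] E.M₀

/-- The transition matrix, in the coordinate `w`, of a bundle with respect to frames over the two
charts: the `j`-th vector of the first frame is `∑ i, (transition b₀ b₁) i j` times the `i`-th
vector of the second one. -/
def transition (E : P1Bundle.{u}) {m n : ℕ} (b₀ : Module.Basis (Fin m) ℂ[X] E.M₀)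
    (b₁ : Module.Basis (Fin n) ℂ[X] E.M₁) : Matrix (Fin n) (Fin m) ℂ[T;T⁻¹] :=
  Matrix.of fun i j => (b₁.baseChange ℂ[T;T⁻¹]).repr (E.glue (1 ⊗ₜ[ℂ[X]] b₀ j)) i

/-- `E` has degree `d`: the determinant bundle of `E` has the transition function `c * w ^ d`, with
a nonzero constant `c`, so that it is isomorphic to `𝒪(d)`. -/
def HasDegree (E : P1Bundle.{u}) (d : ℤ) : Prop :=
  ∃ (n : ℕ) (b₀ : Module.Basis (Fin n) ℂ[X] E.M₀) (b₁ : Module.Basis (Fin n) ℂ[X] E.M₁) (c : ℂ),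
    c ≠ 0 ∧ (E.transition b₀ b₁).det = LaurentPolynomial.C c * LaurentPolynomial.T d

/-- The units of the ring of Laurent polynomials are the nonzero monomials. -/
theorem laurent_isUnit {f : ℂ[T;T⁻¹]} (hf : IsUnit f) :
    ∃ (c : ℂ) (d : ℤ), c ≠ 0 ∧ f = LaurentPolynomial.C c * LaurentPolynomial.T d := by
  obtain ⟨g, hg⟩ := hf.exists_right_inv
  obtain ⟨n, p, hp⟩ := LaurentPolynomial.exists_T_pow f
  obtain ⟨m, q, hq⟩ := LaurentPolynomial.exists_T_pow g
  have hpq : p * q = Polynomial.X ^ (n + m) := by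
    apply Polynomial.toLaurent_injective
    rw [map_mul, hp, hq, Polynomial.toLaurent_X_pow, Nat.cast_add, LaurentPolynomial.T_add]
    calc f * LaurentPolynomial.T n * (g * LaurentPolynomial.T m)
        = (f * g) * (LaurentPolynomial.T n * LaurentPolynomial.T m) := by ring
      _ = _ := by rw [hg, one_mul]
  obtain ⟨i, -, u, hu⟩ := (dvd_prime_pow Polynomial.prime_X _).1 (Dvd.intro q hpq)
  obtain ⟨c, hc, hcu⟩ := Polynomial.isUnit_iff.1 (u⁻¹).isUnit
  refine ⟨c, (i : ℤ) - n, hc.ne_zero, ?_⟩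
  have hpc : p = Polynomial.C c * Polynomial.X ^ i := by
    rw [hcu, ← hu, mul_comm, mul_assoc, Units.mul_inv, mul_one]
  rw [hpc, Polynomial.toLaurent_C_mul_X_pow] at hp
  rw [sub_eq_add_neg, LaurentPolynomial.T_add, ← mul_assoc, hp, mul_assoc,
    ← LaurentPolynomial.T_add, add_neg_cancel, LaurentPolynomial.T_zero, mul_one]

theorem finrank_eq (E : P1Bundle.{u}) :
    Module.finrank ℂ[X] E.M₀ = Module.finrank ℂ[X] E.M₁ := by
  rw [← Module.finrank_baseChange (R := ℂ[T;T⁻¹]) (S := ℂ[X]) (M' := E.M₀),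
    ← Module.finrank_baseChange (R := ℂ[T;T⁻¹]) (S := ℂ[X]) (M' := E.M₁)]
  unfold Module.finrank
  rw [rank_eq_of_equiv_equiv coordInv E.glue.toAddEquiv
    (Function.Involutive.bijective coordInv_coordInv) (fun r m => E.glue.map_smulₛₗ r m)]

theorem glue_basis (E : P1Bundle.{u}) {m n : ℕ} (b₀ : Module.Basis (Fin m) ℂ[X] E.M₀)
    (b₁ : Module.Basis (Fin n) ℂ[X] E.M₁) (j : Fin m) :
    E.glue (1 ⊗ₜ[ℂ[X]] b₀ j) =
      ∑ i, E.transition b₀ b₁ i j • ((1 : ℂ[T;T⁻¹]) ⊗ₜ[ℂ[X]] b₁ i) := by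
  conv_lhs => rw [← (b₁.baseChange ℂ[T;T⁻¹]).sum_repr (E.glue (1 ⊗ₜ[ℂ[X]] b₀ j))]
  simp [transition]

theorem isUnit_det_transition (E : P1Bundle.{u}) {n : ℕ} (b₀ : Module.Basis (Fin n) ℂ[X] E.M₀)
    (b₁ : Module.Basis (Fin n) ℂ[X] E.M₁) : IsUnit (E.transition b₀ b₁).det := by
  classical
  let B₀ := b₀.baseChange ℂ[T;T⁻¹]
  let B : Matrix (Fin n) (Fin n) ℂ[T;T⁻¹] :=
    Matrix.of fun i j => coordInv (B₀.repr (E.glue.symm (1 ⊗ₜ[ℂ[X]] b₁ j)) i)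
  suffices h : E.transition b₀ b₁ * B = 1 by
    have := congrArg Matrix.det h
    rw [Matrix.det_mul, Matrix.det_one] at this
    exact IsUnit.of_mul_eq_one _ this
  ext1 i k
  have hk : (1 : ℂ[T;T⁻¹]) ⊗ₜ[ℂ[X]] b₁ k =
      ∑ j, B j k • E.glue ((1 : ℂ[T;T⁻¹]) ⊗ₜ[ℂ[X]] b₀ j) := by
    conv_lhs => rw [← E.glue.apply_symm_apply ((1 : ℂ[T;T⁻¹]) ⊗ₜ[ℂ[X]] b₁ k),
      ← B₀.sum_repr (E.glue.symm ((1 : ℂ[T;T⁻¹]) ⊗ₜ[ℂ[X]] b₁ k)), map_sum]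
    simp [B, B₀, LinearEquiv.map_smulₛₗ]
  have := congrArg (fun x => (b₁.baseChange ℂ[T;T⁻¹]).repr x i) hk
  simp only [map_sum, map_smul, Finsupp.coe_finsetSum, Finset.sum_apply, Finsupp.smul_apply,
    smul_eq_mul] at this
  rw [Matrix.mul_apply]
  have h1 : (b₁.baseChange ℂ[T;T⁻¹]).repr ((1 : ℂ[T;T⁻¹]) ⊗ₜ[ℂ[X]] b₁ k) i =
      (1 : Matrix (Fin n) (Fin n) ℂ[T;T⁻¹]) i k := by
    rw [← Module.Basis.baseChange_apply, Module.Basis.repr_self, Finsupp.single_apply,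
      Matrix.one_apply]
    simp [eq_comm]
  rw [← h1, this]
  exact Finset.sum_congr rfl fun j _ => mul_comm _ _

theorem exists_hasDegree (E : P1Bundle.{u}) : ∃ d, E.HasDegree d := by
  let b₀ := Module.finBasis ℂ[X] E.M₀
  let b₁ := (Module.finBasis ℂ[X] E.M₁).reindex (finCongr E.finrank_eq.symm)
  obtain ⟨c, d, hc, h⟩ := laurent_isUnit (E.isUnit_det_transition b₀ b₁)
  exact ⟨d, _, b₀, b₁, c, hc, h⟩

theorem transition_eq (E : P1Bundle.{u}) {n : ℕ} (b₀ b₀' : Module.Basis (Fin n) ℂ[X] E.M₀)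
    (b₁ b₁' : Module.Basis (Fin n) ℂ[X] E.M₁) :
    E.transition b₀' b₁' = (b₁'.toMatrix b₁).map Polynomial.toLaurent *
      (E.transition b₀ b₁ * ((b₀.toMatrix b₀').map Polynomial.toLaurent).map coordInv) := by
  ext1 l j
  have h0 : (1 : ℂ[T;T⁻¹]) ⊗ₜ[ℂ[X]] b₀' j =
      ∑ i, Polynomial.toLaurent (b₀.toMatrix b₀' i j) • ((1 : ℂ[T;T⁻¹]) ⊗ₜ[ℂ[X]] b₀ i) := by
    conv_lhs => rw [← b₀.sum_toMatrix_smul_self b₀' j, TensorProduct.tmul_sum]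
    refine Finset.sum_congr rfl fun i _ => ?_
    rw [TensorProduct.tmul_smul, ← LaurentPolynomial.algebraMap_eq_toLaurent, algebraMap_smul]
  have h2 : ∀ k, (b₁'.baseChange ℂ[T;T⁻¹]).repr ((1 : ℂ[T;T⁻¹]) ⊗ₜ[ℂ[X]] b₁ k) l =
      Polynomial.toLaurent (b₁'.toMatrix b₁ l k) := by
    intro k
    rw [Module.Basis.baseChange_repr_tmul, Algebra.smul_def, mul_one]
    rfl
  have h3 : E.transition b₀' b₁' l j =
      (b₁'.baseChange ℂ[T;T⁻¹]).repr (E.glue ((1 : ℂ[T;T⁻¹]) ⊗ₜ[ℂ[X]] b₀' j)) l := rfl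
  rw [h3, h0]
  simp only [map_sum, LinearEquiv.map_smulₛₗ, glue_basis E b₀ b₁, RingHom.id_apply,
    Finsupp.coe_finsetSum, Finset.sum_apply, Finsupp.smul_apply, smul_eq_mul, h2,
    Matrix.mul_apply, Matrix.map_apply, Finset.mul_sum]
  rw [Finset.sum_comm]
  exact Finset.sum_congr rfl fun _ _ => Finset.sum_congr rfl fun _ _ => by ring

/-- The degree does not depend on the frames. -/
theorem HasDegree.unique {E : P1Bundle.{u}} {d d' : ℤ} (h : E.HasDegree d)
    (h' : E.HasDegree d') : d = d' := by
  obtain ⟨n, b₀, b₁, c, hc, h⟩ := h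
  obtain ⟨n', b₀', b₁', c', hc', h'⟩ := h'
  obtain rfl : n = n' := by
    rw [← Fintype.card_fin n, ← Module.finrank_eq_card_basis b₀, Module.finrank_eq_card_basis b₀',
      Fintype.card_fin]
  have hconst : ∀ {M : Type u} [AddCommGroup M] [Module ℂ[X] M]
      (b b' : Module.Basis (Fin n) ℂ[X] M),
      ∃ a : ℂ, a ≠ 0 ∧ (b.toMatrix b').det = Polynomial.C a := by
    intro M _ _ b b'
    have hu : IsUnit (b.toMatrix b').det := by
      rw [← Module.Basis.det_apply]
      exact b.isUnit_det b'
    obtain ⟨a, ha, h⟩ := Polynomial.isUnit_iff.1 hu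
    exact ⟨a, ha.ne_zero, h.symm⟩
  obtain ⟨p, hp, hP⟩ := hconst b₀ b₀'
  obtain ⟨q, hq, hQ⟩ := hconst b₁' b₁
  have key := congrArg Matrix.det (E.transition_eq b₀ b₀' b₁ b₁')
  have hm : ∀ A : Matrix (Fin n) (Fin n) ℂ[X],
      (A.map Polynomial.toLaurent).det = Polynomial.toLaurent A.det :=
    fun A => (RingHom.map_det _ A).symm
  have hm' : ∀ A : Matrix (Fin n) (Fin n) ℂ[T;T⁻¹], (A.map coordInv).det = coordInv A.det :=
    fun A => (RingHom.map_det _ A).symm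
  rw [Matrix.det_mul, Matrix.det_mul, hm', hm, hm, hP, hQ, h, h', Polynomial.toLaurent_C,
    Polynomial.toLaurent_C, coordInv_apply, LaurentPolynomial.invert_C] at key
  have key' : (LaurentPolynomial.C c' * LaurentPolynomial.T d' : ℂ[T;T⁻¹]) =
      LaurentPolynomial.C (q * c * p) * LaurentPolynomial.T d := by
    rw [key, map_mul, map_mul]
    ring
  have := congrArg LaurentPolynomial.degree key'
  rw [LaurentPolynomial.degree_C_mul_T _ _ hc',
    LaurentPolynomial.degree_C_mul_T _ _ (mul_ne_zero (mul_ne_zero hq hc) hp)] at this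
  exact (WithBot.coe_injective this).symm

/-- The degree of a vector bundle. -/
def degree (E : P1Bundle.{u}) : ℤ := Classical.choose E.exists_hasDegree

theorem hasDegree_degree (E : P1Bundle.{u}) : E.HasDegree E.degree :=
  Classical.choose_spec E.exists_hasDegree

/-- The slope of a vector bundle, for nonzero bundles. -/
def slope (E : P1Bundle.{u}) : ℚ := E.degree / E.rank

/-- A morphism of vector bundles (of their sheaves of sections): a linear map over each chart,
compatible with the gluing isomorphisms over the punctured line. -/
structure Hom (E F : P1Bundle.{u}) where
  φ₀ : E.M₀ →ₗ[ℂ[X]] F.M₀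
  φ₁ : E.M₁ →ₗ[ℂ[X]] F.M₁
  comm : ∀ x, F.glue (φ₀.baseChange ℂ[T;T⁻¹] x) = φ₁.baseChange ℂ[T;T⁻¹] (E.glue x)

/-- The morphism is injective on sections, so that it presents `E` as a coherent subsheaf
of `F`. -/
def Hom.IsMono {E F : P1Bundle.{u}} (φ : Hom E F) : Prop :=
  Function.Injective φ.φ₀ ∧ Function.Injective φ.φ₁

/-- Semistability: no nonzero coherent subsheaf has a larger slope.  On a smooth curve the coherent
subsheaves of a vector bundle are themselves vector bundles. -/
def IsSemistable (E : P1Bundle.{u}) : Prop :=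
  ∀ (F : P1Bundle.{u}) (φ : Hom F E), φ.IsMono → F.rank ≠ 0 → F.slope ≤ E.slope

/-- Semistable of slope `μ`.  As usual, the zero bundle is semistable of every slope. -/
def IsSemistableOfSlope (E : P1Bundle.{u}) (μ : ℚ) : Prop :=
  E.IsSemistable ∧ (E.rank ≠ 0 → E.slope = μ)

end P1Bundle

/-! ### Filtrations and the Rees–Simpson bundle -/

/-- A complete decreasing filtration, indexed by the integers: it is the whole space in small
degrees and zero in large ones. -/
structure CompleteFiltration (V : Type u) [AddCommGroup V] [Module ℂ V] where
  F : ℤ → Submodule ℂ V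
  antitone : Antitone F
  exists_eq_top : ∃ a, F a = ⊤
  exists_eq_bot : ∃ b, F b = ⊥

section PuncturedSections

variable (V : Type u) [AddCommGroup V] [Module ℂ V]

/-- The sections `ℂ[z, z⁻¹] ⊗ V` of the trivial bundle with fibre `V` over the punctured line. -/
def PuncturedSections : Type u := ℂ[T;T⁻¹] ⊗[ℂ] V

namespace PuncturedSections

instance : AddCommGroup (PuncturedSections V) :=
  inferInstanceAs (AddCommGroup (ℂ[T;T⁻¹] ⊗[ℂ] V))

instance : Module ℂ[T;T⁻¹] (PuncturedSections V) :=
  inferInstanceAs (Module ℂ[T;T⁻¹] (ℂ[T;T⁻¹] ⊗[ℂ] V))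

/-- Polynomials act as Laurent polynomials. -/
instance : Module ℂ[X] (PuncturedSections V) :=
  Module.compHom _ (algebraMap ℂ[X] ℂ[T;T⁻¹])

instance : IsScalarTower ℂ[X] ℂ[T;T⁻¹] (PuncturedSections V) :=
  IsScalarTower.of_algebraMap_smul fun _ _ => rfl

variable {V}

/-- The section `f(z) v`. -/
def tm (f : ℂ[T;T⁻¹]) (v : V) : PuncturedSections V := f ⊗ₜ[ℂ] v

theorem smul_tm (f g : ℂ[T;T⁻¹]) (v : V) : f • tm g v = tm (f * g) v := rfl

theorem tm_add (f : ℂ[T;T⁻¹]) (v v' : V) : tm f (v + v') = tm f v + tm f v' :=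
  TensorProduct.tmul_add f v v'

theorem tm_zero (f : ℂ[T;T⁻¹]) : tm f (0 : V) = 0 := TensorProduct.tmul_zero V f

theorem add_tm (f g : ℂ[T;T⁻¹]) (v : V) : tm (f + g) v = tm f v + tm g v :=
  TensorProduct.add_tmul f g v

theorem tm_smul (f : ℂ[T;T⁻¹]) (c : ℂ) (v : V) :
    tm f (c • v) = LaurentPolynomial.C c • tm f v := by
  rw [smul_tm, ← LaurentPolynomial.smul_eq_C_mul]
  exact TensorProduct.tmul_smul c f v

theorem X_pow_smul (n : ℕ) (x : PuncturedSections V) :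
    (Polynomial.X ^ n : ℂ[X]) • x = (LaurentPolynomial.T n : ℂ[T;T⁻¹]) • x := by
  rw [← algebraMap_smul ℂ[T;T⁻¹] (Polynomial.X ^ n : ℂ[X]) x, LaurentPolynomial.algebraMap_X_pow]

theorem C_smul (c : ℂ) (x : PuncturedSections V) :
    (Polynomial.C c : ℂ[X]) • x = (LaurentPolynomial.C c : ℂ[T;T⁻¹]) • x := by
  rw [← algebraMap_smul ℂ[T;T⁻¹] (Polynomial.C c : ℂ[X]) x,
    LaurentPolynomial.algebraMap_eq_toLaurent, Polynomial.toLaurent_C]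

@[elab_as_elim]
theorem induction {p : PuncturedSections V → Prop} (x : PuncturedSections V) (zero : p 0)
    (tm : ∀ f v, p (tm f v)) (add : ∀ x y, p x → p y → p (x + y)) : p x :=
  TensorProduct.induction_on x zero tm add

instance : Module.IsTorsionFree ℂ[X] (PuncturedSections V) :=
  have : Module.IsTorsionFree ℂ[T;T⁻¹] (PuncturedSections V) :=
    inferInstanceAs (Module.IsTorsionFree ℂ[T;T⁻¹] (ℂ[T;T⁻¹] ⊗[ℂ] V))
  have : FaithfulSMul ℂ[X] ℂ[T;T⁻¹] :=
    (faithfulSMul_iff_algebraMap_injective _ _).2 Polynomial.toLaurent_injective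
  .trans_faithfulSMul ℂ[X] ℂ[T;T⁻¹] _

variable (V) in
/-- The map `f(z) v ↦ f(z⁻¹) v` of sections induced by `(v, z) ↦ (v, z⁻¹)`. -/
def swap : PuncturedSections V ≃ₛₗ[coordInv] PuncturedSections V :=
  { (TensorProduct.congr (LaurentPolynomial.invert (R := ℂ)).toLinearEquiv
      (LinearEquiv.refl ℂ V)).toAddEquiv with
    map_smul' := fun f x => by
      induction x using PuncturedSections.induction with
      | zero => rw [smul_zero]; exact (map_zero (TensorProduct.congr _ _)).trans (smul_zero _).symm
      | tm g v =>
        change tm (LaurentPolynomial.invert (f * g)) v = tm (coordInv f * _) v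
        rw [map_mul]
        rfl
      | add x y hx hy =>
        rw [smul_add]
        refine (map_add (TensorProduct.congr _ _) (f • x) (f • y)).trans ?_
        refine (congrArg₂ (· + ·) hx hy).trans ?_
        refine (smul_add (A := PuncturedSections V) (coordInv f) _ _).symm.trans ?_
        exact congrArg _ (map_add (TensorProduct.congr _ _) x y).symm }

theorem swap_tm (f : ℂ[T;T⁻¹]) (v : V) : swap V (tm f v) = tm (LaurentPolynomial.invert f) v := rfl

end PuncturedSections

end PuncturedSections

namespace CompleteFiltration

open PuncturedSections

variable {V : Type u} [AddCommGroup V] [Module ℂ V]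

/-- `V` is the direct sum of the subspaces `V^{k,m} = F^k ⊓ G^m` with `k + m = w`. -/
def IsPureOfWeight (F G : CompleteFiltration V) (w : ℤ) : Prop :=
  DirectSum.IsInternal fun k : ℤ => F.F k ⊓ G.F (w - k)

/-- The Rees module: the `ℂ[z]`-submodule of `ℂ[z, z⁻¹] ⊗ V` generated by the elements
`z⁻ᵏ v` with `v ∈ F^k`. -/
def rees (F : CompleteFiltration V) : Submodule ℂ[X] (PuncturedSections V) :=
  Submodule.span ℂ[X] {x | ∃ (k : ℤ) (v : V), v ∈ F.F k ∧ x = tm (LaurentPolynomial.T (-k)) v}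

instance finite_rees [Module.Finite ℂ V] (F : CompleteFiltration V) :
    Module.Finite ℂ[X] F.rees := by
  obtain ⟨b, hb⟩ := F.exists_eq_bot
  let B := Module.finBasis ℂ V
  let N : Submodule ℂ[X] (PuncturedSections V) :=
    Submodule.span ℂ[X] (Set.range fun i => tm (LaurentPolynomial.T (-b)) (B i))
  have hN : Module.Finite ℂ[X] N := Module.Finite.span_of_finite _ (Set.finite_range _)
  have key : ∀ v : V, tm (LaurentPolynomial.T (-b)) v ∈ N := by
    intro v
    rw [← B.sum_repr v]
    refine Finset.sum_induction _ (fun v => tm (LaurentPolynomial.T (-b)) v ∈ N)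
      (fun v v' hv hv' => by rw [tm_add]; exact N.add_mem hv hv')
      (by rw [tm_zero]; exact N.zero_mem) fun i _ => ?_
    rw [tm_smul, ← C_smul]
    exact N.smul_mem _ (Submodule.subset_span ⟨i, rfl⟩)
  have hle : F.rees ≤ N := by
    refine Submodule.span_le.2 ?_
    rintro x ⟨k, v, hv, rfl⟩
    rcases le_total k b with hkb | hkb
    · obtain ⟨n, hn⟩ := Int.eq_ofNat_of_zero_le (sub_nonneg.2 hkb)
      have : tm (LaurentPolynomial.T (-k)) v =
          (Polynomial.X ^ n : ℂ[X]) • tm (LaurentPolynomial.T (-b)) v := by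
        rw [X_pow_smul, smul_tm, ← LaurentPolynomial.T_add]
        congr 2
        omega
      rw [this]
      exact N.smul_mem _ (key v)
    · have : v = 0 := by
        have := F.antitone hkb hv
        rwa [hb, Submodule.mem_bot] at this
      rw [this, tm_zero]
      exact N.zero_mem
  exact Module.Finite.of_injective (Submodule.inclusion hle) (Submodule.inclusion_injective hle)

instance projective_rees [Module.Finite ℂ V] (F : CompleteFiltration V) :
    Module.Projective ℂ[X] F.rees :=
  have : Module.Free ℂ[X] F.rees := Module.free_of_finite_type_torsion_free'
  inferInstance

/-- The inclusion of the Rees module is its restriction to the punctured line. -/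
theorem isLocalizedModule_rees (F : CompleteFiltration V) :
    IsLocalizedModule (Submonoid.powers (Polynomial.X : ℂ[X])) F.rees.subtype where
  map_units := by
    rintro ⟨_, n, rfl⟩
    have h : algebraMap ℂ[X] (Module.End ℂ[X] (PuncturedSections V)) (Polynomial.X ^ n) =
        Module.toModuleEnd ℂ[X] (S := ℂ[T;T⁻¹]) (PuncturedSections V) (LaurentPolynomial.T n) :=
      LinearMap.ext fun x => X_pow_smul n x
    rw [h]
    exact (LaurentPolynomial.isUnit_T n).map _
  surj := by
    intro y
    suffices h : ∃ n : ℕ, (Polynomial.X ^ n : ℂ[X]) • y ∈ F.rees by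
      obtain ⟨n, hn⟩ := h
      exact ⟨(⟨_, hn⟩, ⟨Polynomial.X ^ n, n, rfl⟩), rfl⟩
    obtain ⟨a, ha⟩ := F.exists_eq_top
    induction y using PuncturedSections.induction with
    | zero => exact ⟨0, by rw [smul_zero]; exact F.rees.zero_mem⟩
    | tm f v =>
      obtain ⟨n, f', hf⟩ := LaurentPolynomial.exists_T_pow f
      refine ⟨n + a.natAbs, ?_⟩
      have h : (Polynomial.X ^ (n + a.natAbs) : ℂ[X]) • tm f v =
          (f' * Polynomial.X ^ (a.natAbs + a).toNat : ℂ[X]) • tm (LaurentPolynomial.T (-a)) v := by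
        rw [X_pow_smul, smul_tm, mul_smul, X_pow_smul, smul_tm,
          ← algebraMap_smul ℂ[T;T⁻¹] f', smul_tm, LaurentPolynomial.algebraMap_eq_toLaurent, hf,
          ← LaurentPolynomial.T_add, mul_assoc, ← LaurentPolynomial.T_add, mul_comm]
        congr 3
        omega
      rw [h]
      exact F.rees.smul_mem _ (Submodule.subset_span ⟨a, v, ha ▸ Submodule.mem_top, rfl⟩)
    | add x y hx hy =>
      obtain ⟨m, hm⟩ := hx
      obtain ⟨n, hn⟩ := hy
      refine ⟨m + n, ?_⟩
      rw [smul_add]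
      refine F.rees.add_mem ?_ ?_
      · rw [pow_add, mul_comm, mul_smul]
        exact F.rees.smul_mem _ hm
      · rw [pow_add, mul_smul]
        exact F.rees.smul_mem _ hn
  exists_of_eq := fun h => ⟨1, by rw [Subtype.coe_injective h]⟩

/-- Over the punctured line the bundle of the Rees module is the trivial one, by `f ⊗ s ↦ f s`. -/
def reesTrivialization (F : CompleteFiltration V) :
    (ℂ[T;T⁻¹] ⊗[ℂ[X]] F.rees) ≃ₗ[ℂ[T;T⁻¹]] PuncturedSections V :=
  ((isLocalizedModule_iff_isBaseChange (Submonoid.powers (Polynomial.X : ℂ[X])) ℂ[T;T⁻¹]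
    F.rees.subtype).1 F.isLocalizedModule_rees).equiv

theorem reesTrivialization_tmul (F : CompleteFiltration V) (f : ℂ[T;T⁻¹]) (s : F.rees) :
    F.reesTrivialization (f ⊗ₜ s) = f • (s : PuncturedSections V) :=
  IsBaseChange.equiv_tmul _ _ _

/-- The Rees–Simpson bundle of a vector space with two filtrations: the bundles of the two Rees
modules on the two charts, glued along `(v, z) ↦ (v, z⁻¹)` by means of their trivializations over
the punctured line. -/
def reesSimpson [Module.Finite ℂ V] (F G : CompleteFiltration V) : P1Bundle.{u} where
  M₀ := F.rees
  M₁ := G.rees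
  glue := (F.reesTrivialization.trans (swap V)).trans G.reesTrivialization.symm

end CompleteFiltration

end

/-! Choose a basis `b` of V adapted to the first filtration, with weights p i, and a basis `c`
adapted to the second, with weights q i. The elements z^(-p i) b i and their analogues for `c` are
frames of the two Rees modules. In these frames the transition matrix is the constant base change
matrix with row i multiplied by T^(q i) and column j by T^(p j). Hence the bundle has rank dim V and
degree ∑ p i + ∑ q i (`transition_reesSimpson`, `hasDegree_reesSimpson`).

Semistable implies pure. A nonzero v in F^k ∩ G^m spans a line whose Rees–Simpson bundle is a
subsheaf of degree k + m, so F^k and G^m are disjoint once k + m > w. Thus dim F^k + dim G^(w+1-k) ≤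
dim V for every k. The degree is the sum of all weights, and slope w says precisely that these
inequalities, added over a large interval, become an equality. Each of them is then an equality, the
filtrations are opposed, and F^k ∩ G^(w-k) is a complement of F^(k+1) in F^k.

Pure implies semistable. Bases of the summands V^{k,w-k} form one basis adapted to both filtrations,
with weights p i and w - p i, so the transition matrix is the scalar T^w. For a subsheaf of rank r
and degree d, a nonzero r × r minor of the inclusion gives an identity between a polynomial in T⁻¹
and T^(d-rw) times a polynomial in T, which is impossible if d > rw. -/

noncomputable section

/-! ### Adapted bases and opposed filtrations -/

/-- A basis of an internal direct sum which consists of bases of the summands. -/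
theorem DirectSum.IsInternal.exists_fin_basis {ι K V : Type*} [DecidableEq ι] [Field K]
    [AddCommGroup V] [Module K V] [Module.Finite K V] {C : ι → Submodule K V}
    (h : DirectSum.IsInternal C) :
    ∃ (n : ℕ) (b : Module.Basis (Fin n) K V) (p : Fin n → ι),
      ∀ j, C j = Submodule.span K (b '' {i | p i = j}) := by
  let b := h.collectedBasis fun j => Module.finBasis K (C j)
  have : Finite (Σ j, Fin (Module.finrank K (C j))) := Module.Finite.finite_basis b
  let e := Finite.equivFin (Σ j, Fin (Module.finrank K (C j)))
  refine ⟨_, b.reindex e, fun i => (e.symm i).1, fun j => le_antisymm ?_ ?_⟩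
  · intro v hv
    have h1 := (Module.finBasis K (C j)).sum_repr ⟨v, hv⟩
    have h2 : v = ∑ i, (Module.finBasis K (C j)).repr ⟨v, hv⟩ i •
        ((Module.finBasis K (C j) i : C j) : V) := by
      have h3 := congrArg (C j).subtype h1.symm
      rwa [map_sum] at h3
    rw [h2]
    refine Submodule.sum_mem _ fun i _ => Submodule.smul_mem _ _ (Submodule.subset_span ?_)
    refine ⟨e ⟨j, i⟩, by simp, ?_⟩
    rw [Module.Basis.reindex_apply, e.symm_apply_apply]
    simp [b]
  · rw [Submodule.span_le]
    rintro _ ⟨i, rfl, rfl⟩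
    rw [Module.Basis.reindex_apply]
    exact h.collectedBasis_mem _ _

namespace CompleteFiltration

variable {V : Type u} [AddCommGroup V] [Module ℂ V]

/-- The basis `b` is adapted to `F` with weights `p`: each `F^k` is spanned by the basis vectors
of weight at least `k`. -/
def IsAdapted (F : CompleteFiltration V) {ι : Type*} (b : Module.Basis ι ℂ V) (p : ι → ℤ) : Prop :=
  ∀ k, F.F k = Submodule.span ℂ (b '' {i | k ≤ p i})

theorem IsAdapted.mem {F : CompleteFiltration V} {ι : Type*} {b : Module.Basis ι ℂ V} {p : ι → ℤ}
    (h : F.IsAdapted b p) (i : ι) : b i ∈ F.F (p i) :=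
  h (p i) ▸ Submodule.subset_span ⟨i, le_refl (p i), rfl⟩

/-- Descending induction along a complete filtration. -/
theorem descending_induction (F : CompleteFiltration V) {P : ℤ → Prop}
    (bot : ∀ k, F.F k = ⊥ → P k) (step : ∀ k, P (k + 1) → P k) (k : ℤ) : P k := by
  obtain ⟨b, hb⟩ := F.exists_eq_bot
  rcases le_total b k with hk | hk
  · exact bot k (le_bot_iff.1 (hb ▸ F.antitone hk))
  · induction k, hk using Int.leInductionDown with
    | base => exact bot b hb
    | pred n _ ih => exact step _ (by simpa using ih)

/-- The C k form a splitting of the filtration. In a relation ∑ x_k = 0 with least index K, all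
other terms lie in F^(K+1), so x_K lies in C K ∩ F^(K+1) = 0. Descending induction shows that the C
k span V. -/
theorem isInternal_of_complement (F : CompleteFiltration V) {C : ℤ → Submodule ℂ V}
    (hle : ∀ k, C k ≤ F.F k) (hinf : ∀ k, Disjoint (C k) (F.F (k + 1)))
    (hsup : ∀ k, F.F k ≤ C k ⊔ F.F (k + 1)) : DirectSum.IsInternal C := by
  rw [DirectSum.isInternal_submodule_iff_iSupIndep_and_iSup_eq_top]
  constructor
  · refine iSupIndep_of_dfinsupp_lsum_injective _ ((injective_iff_map_eq_zero _).2 fun x hx => ?_)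
    classical
    by_contra hne
    have hs : x.support.Nonempty := Finset.nonempty_iff_ne_empty.2 fun h =>
      hne (DFinsupp.support_eq_empty.1 h)
    set K := x.support.min' hs
    have hK : K ∈ x.support := Finset.min'_mem _ _
    refine DFinsupp.mem_support_iff.1 hK (Subtype.ext ?_)
    refine Submodule.disjoint_def.1 (hinf K) _ (x K).2 ?_
    rw [DFinsupp.lsum_apply_apply, DFinsupp.sumAddHom_apply, DFinsupp.sum,
      ← Finset.add_sum_erase _ _ hK] at hx
    have hx' := eq_neg_of_add_eq_zero_left hx
    simp only [LinearMap.toAddMonoidHom_coe, Submodule.subtype_apply] at hx'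
    rw [hx']
    refine Submodule.neg_mem _ (Submodule.sum_mem _ fun j hj => ?_)
    rw [Finset.mem_erase] at hj
    have : K ≤ j := Finset.min'_le _ _ hj.2
    exact F.antitone (show K + 1 ≤ j by omega) (hle j (x j).2)
  · have : ∀ k, F.F k ≤ ⨆ j, C j := by
      refine F.descending_induction (fun k hk => hk ▸ bot_le) fun k ih => ?_
      exact (hsup k).trans (sup_le (le_iSup C k) ih)
    obtain ⟨a, ha⟩ := F.exists_eq_top
    exact top_le_iff.1 (ha ▸ this a)

theorem exists_isAdapted_of_complement [Module.Finite ℂ V] (F : CompleteFiltration V)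
    {C : ℤ → Submodule ℂ V}
    (hle : ∀ k, C k ≤ F.F k) (hinf : ∀ k, Disjoint (C k) (F.F (k + 1)))
    (hsup : ∀ k, F.F k ≤ C k ⊔ F.F (k + 1)) :
    ∃ (n : ℕ) (b : Module.Basis (Fin n) ℂ V) (p : Fin n → ℤ), F.IsAdapted b p := by
  obtain ⟨n, b, p, hC⟩ := (F.isInternal_of_complement hle hinf hsup).exists_fin_basis
  refine ⟨n, b, p, fun k => le_antisymm ?_ ?_⟩
  · induction k using F.descending_induction with
    | bot k hk => exact hk ▸ bot_le
    | step k ih =>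
      refine (hsup k).trans (sup_le ?_ (ih.trans ?_))
      · rw [hC]
        exact Submodule.span_mono (Set.image_mono fun i hi => (Eq.ge hi))
      · exact Submodule.span_mono (Set.image_mono fun i (hi : k + 1 ≤ p i) => by
          simp only [Set.mem_ofPred_eq]; omega)
  · rw [Submodule.span_le]
    rintro _ ⟨i, hi, rfl⟩
    refine F.antitone hi (hle _ ?_)
    rw [hC]
    exact Submodule.subset_span ⟨i, rfl, rfl⟩

theorem exists_isAdapted [Module.Finite ℂ V] (F : CompleteFiltration V) :
    ∃ (n : ℕ) (b : Module.Basis (Fin n) ℂ V) (p : Fin n → ℤ), F.IsAdapted b p := by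
  have h : ∀ k, ∃ C : Submodule ℂ V, Disjoint (F.F (k + 1)) C ∧ F.F (k + 1) ⊔ C = F.F k := by
    intro k
    obtain ⟨D, hD⟩ := Submodule.exists_isCompl (F.F (k + 1))
    refine ⟨D ⊓ F.F k, hD.disjoint.mono_right inf_le_left, ?_⟩
    -- Modular law: a complement of F^(k+1) in V, cut down to F^k, is a complement in F^k.
    rw [← sup_inf_assoc_of_le D (F.antitone (Int.le_add_one le_rfl)), hD.sup_eq_top, top_inf_eq]
  choose C hC hC' using h
  exact F.exists_isAdapted_of_complement (C := C) (fun k => hC' k ▸ le_sup_right)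
    (fun k => (hC k).symm) (fun k => by rw [sup_comm, hC'])

/-- Since k + m > w, a vector of F^k ∩ G^m lies in both V^{k,w-k} and V^{k-1,w-k+1}, two distinct
summands. -/
theorem IsPureOfWeight.disjoint {F G : CompleteFiltration V} {w : ℤ} (h : F.IsPureOfWeight G w)
    {k m : ℤ} (hkm : w < k + m) : Disjoint (F.F k) (G.F m) := by
  have h1 := (DirectSum.isInternal_submodule_iff_iSupIndep_and_iSup_eq_top _).1 h |>.1
  have h2 := h1.pairwiseDisjoint (show k ≠ k - 1 by omega)
  rw [Submodule.disjoint_def]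
  intro x hx hx'
  refine Submodule.disjoint_def.1 h2 x ?_ ?_
  · exact ⟨hx, G.antitone (by omega) hx'⟩
  · exact ⟨F.antitone (by omega) hx, G.antitone (by omega) hx'⟩

/-- Split v in F^k into its parts of weight at least k and less than k. The first lies in F^k, hence
so does the second, which must vanish. -/
theorem isAdapted_of_disjoint {F : CompleteFiltration V} {ι : Type*} [Fintype ι]
    {b : Module.Basis ι ℂ V} {p : ι → ℤ} (hb : ∀ i, b i ∈ F.F (p i))
    (h : ∀ k, Disjoint (F.F k) (Submodule.span ℂ (b '' {i | p i < k}))) : F.IsAdapted b p := by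
  classical
  have hle : ∀ k, Submodule.span ℂ (b '' {i | k ≤ p i}) ≤ F.F k := by
    intro k
    rw [Submodule.span_le]
    rintro _ ⟨i, hi, rfl⟩
    exact F.antitone hi (hb i)
  refine fun k => le_antisymm (fun v hv => ?_) (hle k)
  have hv' : v ∈ Submodule.span ℂ (b '' {i | k ≤ p i}) ⊔ Submodule.span ℂ (b '' {i | p i < k}) := by
    rw [← Submodule.span_union, ← Set.image_union]
    have : ({i | k ≤ p i} ∪ {i | p i < k} : Set ι) = Set.univ :=
      Set.eq_univ_of_forall fun i => le_or_gt k (p i)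
    rw [this, Set.image_univ, b.span_eq]
    trivial
  obtain ⟨x, hx, y, hy, rfl⟩ := Submodule.mem_sup.1 hv'
  have : y = 0 := Submodule.disjoint_def.1 (h k) y
    (by simpa using (F.F k).sub_mem hv (hle k hx)) hy
  simpa [this] using hx

/-- Basis vectors of F-weight less than k lie in G^(w-k+1), which is disjoint from F^k by purity;
the argument for G is symmetric. This is what `isAdapted_of_disjoint` requires. -/
theorem IsPureOfWeight.exists_isAdapted [Module.Finite ℂ V] {F G : CompleteFiltration V} {w : ℤ}
    (h : F.IsPureOfWeight G w) :
    ∃ (n : ℕ) (b : Module.Basis (Fin n) ℂ V) (p : Fin n → ℤ),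
      F.IsAdapted b p ∧ G.IsAdapted b (fun i => w - p i) := by
  obtain ⟨n, b, p, hC⟩ := DirectSum.IsInternal.exists_fin_basis h
  have hb : ∀ i, b i ∈ F.F (p i) ⊓ G.F (w - p i) := by
    intro i
    refine (hC (p i)).ge ?_
    exact Submodule.subset_span ⟨i, rfl, rfl⟩
  refine ⟨n, b, p, isAdapted_of_disjoint (fun i => (hb i).1) fun k => ?_,
    isAdapted_of_disjoint (fun i => (hb i).2) fun m => ?_⟩
  · refine (h.disjoint (show w < k + (w - k + 1) by omega)).mono_right ?_
    rw [Submodule.span_le]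
    rintro _ ⟨i, hi, rfl⟩
    exact G.antitone (by simp only [Set.mem_ofPred_eq] at hi; omega) (hb i).2
  · refine (h.disjoint (show w < (w - m + 1) + m by omega)).symm.mono_right ?_
    rw [Submodule.span_le]
    rintro _ ⟨i, hi, rfl⟩
    exact F.antitone (by simp only [Set.mem_ofPred_eq] at hi; omega) (hb i).1

theorem IsAdapted.finrank {F : CompleteFiltration V} {ι : Type*} [Fintype ι]
    {b : Module.Basis ι ℂ V} {p : ι → ℤ} (h : F.IsAdapted b p) (k : ℤ) :
    Module.finrank ℂ (F.F k) = (Finset.univ.filter fun i => k ≤ p i).card := by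
  have := finrank_span_eq_card (b.linearIndependent.comp
    (Subtype.val : {i // k ≤ p i} → ι) Subtype.val_injective)
  rw [Set.range_comp, Subtype.range_coe_subtype] at this
  rw [h k, this, Fintype.card_subtype]

/-- Two filtrations which are disjoint above the antidiagonal of weight `w` and whose weights have
the right sum are opposed. -/
theorem finrank_add_finrank {ι : Type*} [Fintype ι] [Module.Finite ℂ V]
    {F G : CompleteFiltration V} {w : ℤ} {b c : Module.Basis ι ℂ V} {p q : ι → ℤ}
    (hF : F.IsAdapted b p) (hG : G.IsAdapted c q)
    (hdisj : ∀ k m, w < k + m → Disjoint (F.F k) (G.F m))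
    (hsum : ∑ i, p i + ∑ i, q i = Fintype.card ι * w) (k : ℤ) :
    Module.finrank ℂ (F.F k) + Module.finrank ℂ (G.F (w + 1 - k)) = Module.finrank ℂ V := by
  classical
  have hle : ∀ k, Module.finrank ℂ (F.F k) + Module.finrank ℂ (G.F (w + 1 - k)) ≤
      Module.finrank ℂ V := fun k =>
    Submodule.finrank_add_finrank_le_of_disjoint (hdisj k (w + 1 - k) (by omega))
  obtain ⟨N, hN⟩ : ∃ N : ℤ, ∀ i, |p i| + |q i| + |w| + |k| + 1 ≤ N := by
    obtain ⟨N, hN⟩ := (Set.finite_range fun i => |p i| + |q i| + |w| + |k| + 1).bddAbove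
    exact ⟨N, fun i => hN ⟨i, rfl⟩⟩
  -- Without an index the bounds on N are vacuous, but then V = 0 and the inequality already gives
  -- the claim.
  rcases isEmpty_or_nonempty ι with hι | ⟨⟨i₀⟩⟩
  · have := Module.finrank_eq_card_basis b
    have := hle k
    simp_all
  let S := Finset.Ioc (-N) N
  have hk : k ∈ S := by
    have := hN i₀
    simp only [S, Finset.mem_Ioc]
    grind
  -- Counting pairs the other way round: `b i` lies in F^k for the p i + N values of k in (-N, p i].
  have h1 : ∑ k ∈ S, (Module.finrank ℂ (F.F k) : ℤ) = ∑ i, (p i + N) := by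
    simp only [hF.finrank, Finset.card_filter, Nat.cast_sum]
    rw [Finset.sum_comm]
    refine Finset.sum_congr rfl fun i _ => ?_
    have h2 : S.filter (fun k => k ≤ p i) = Finset.Ioc (-N) (p i) := by
      ext j
      have := hN i
      simp only [S, Finset.mem_filter, Finset.mem_Ioc]
      grind
    rw [← Nat.cast_sum, ← Finset.card_filter, h2, Int.card_Ioc]
    have := hN i
    grind
  -- Here w + 1 - k ≤ q i means k > w - q i, which leaves N - w + q i values of k.
  have h3 : ∑ k ∈ S, (Module.finrank ℂ (G.F (w + 1 - k)) : ℤ) = ∑ i, (q i + N - w) := by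
    simp only [hG.finrank, Finset.card_filter, Nat.cast_sum]
    rw [Finset.sum_comm]
    refine Finset.sum_congr rfl fun i _ => ?_
    have h2 : S.filter (fun k => w + 1 - k ≤ q i) = Finset.Ioc (w - q i) N := by
      ext j
      have := hN i
      simp only [S, Finset.mem_filter, Finset.mem_Ioc]
      grind
    rw [← Nat.cast_sum, ← Finset.card_filter, h2, Int.card_Ioc]
    have := hN i
    grind
  -- By `hsum` the two counts add up to 2N · dim V, the sum of the upper bounds, so no single
  -- inequality can be strict.
  have h4 : ∑ k ∈ S, (Module.finrank ℂ (F.F k) + Module.finrank ℂ (G.F (w + 1 - k))) =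
      ∑ k ∈ S, Module.finrank ℂ V := by
    zify
    rw [Finset.sum_add_distrib, h1, h3, Finset.sum_const, Int.card_Ioc,
      Module.finrank_eq_card_basis b]
    simp only [Finset.sum_add_distrib, Finset.sum_sub_distrib, Finset.sum_const, Finset.card_univ,
      nsmul_eq_mul]
    have : ((N - -N).toNat : ℤ) = 2 * N := by
      have := hN i₀
      grind
    rw [this]
    linarith
  exact (Finset.sum_eq_sum_iff_of_le fun k _ => hle k).1 h4 k hk

/-- The dimension count gives F^(k+1) ⊕ G^(w-k) = V. Intersecting with F^k, by the modular law,
makes F^k ∩ G^(w-k) a complement of F^(k+1) in F^k. -/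
theorem isPureOfWeight_of_opposed [Module.Finite ℂ V] {F G : CompleteFiltration V} {w : ℤ}
    (hdisj : ∀ k m, w < k + m → Disjoint (F.F k) (G.F m))
    (hdim : ∀ k, Module.finrank ℂ (F.F k) + Module.finrank ℂ (G.F (w + 1 - k)) =
      Module.finrank ℂ V) : F.IsPureOfWeight G w := by
  refine F.isInternal_of_complement (fun k => inf_le_left)
    (fun k => (hdisj (k + 1) (w - k) (by omega)).symm.mono_left inf_le_right) fun k => ?_
  have htop : F.F (k + 1) ⊔ G.F (w - k) = ⊤ := by
    refine Submodule.eq_top_of_disjoint _ _ ?_ (hdisj _ _ (by omega))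
    rw [← hdim (k + 1), add_sub_add_right_eq_sub]
  rw [sup_comm, inf_comm, ← sup_inf_assoc_of_le _ (F.antitone (Int.le_add_one le_rfl)), htop,
    top_inf_eq]

end CompleteFiltration

/-! ### Frames, transition matrix and degree of the Rees–Simpson bundle -/

namespace CompleteFiltration

open PuncturedSections

variable {V : Type u} [AddCommGroup V] [Module ℂ V]

theorem tm_T_mem_rees (F : CompleteFiltration V) {k j : ℤ} {v : V} (hv : v ∈ F.F k)
    (hj : -k ≤ j) : tm (LaurentPolynomial.T j) v ∈ F.rees := by
  obtain ⟨n, hn⟩ := Int.eq_ofNat_of_zero_le (show 0 ≤ j + k by omega)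
  have : tm (LaurentPolynomial.T j) v =
      (Polynomial.X ^ n : ℂ[X]) • tm (LaurentPolynomial.T (-k)) v := by
    rw [X_pow_smul, smul_tm, ← LaurentPolynomial.T_add]
    congr 2
    omega
  rw [this]
  exact F.rees.smul_mem _ (Submodule.subset_span ⟨k, v, hv, rfl⟩)

/-- Over the Laurent polynomials this family is a basis of the trivial bundle rescaled by units;
independence then descends to polynomial coefficients. -/
theorem linearIndependent_tm {ι : Type*} (b : Module.Basis ι ℂ V) (p : ι → ℤ) :
    LinearIndependent ℂ[X] fun i => tm (LaurentPolynomial.T (-p i)) (b i) := by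
  have h1 : LinearIndependent ℂ[T;T⁻¹] fun i => tm (1 : ℂ[T;T⁻¹]) (b i) := by
    have := (b.baseChange ℂ[T;T⁻¹]).linearIndependent
    simp only [funext (Module.Basis.baseChange_apply ℂ[T;T⁻¹] b)] at this
    exact this
  have h2 := h1.units_smul fun i => (LaurentPolynomial.isUnit_T (R := ℂ) (-p i)).unit
  have h3 : (fun i => tm (LaurentPolynomial.T (-p i)) (b i)) =
      (fun i => (LaurentPolynomial.isUnit_T (R := ℂ) (-p i)).unit) •
        fun i => tm (1 : ℂ[T;T⁻¹]) (b i) := by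
    funext i
    simp only [Pi.smul_apply', Units.smul_def, IsUnit.unit_spec, smul_tm, mul_one]
  rw [h3]
  refine h2.restrict_scalars fun x y hxy => ?_
  simp only [Algebra.smul_def, mul_one] at hxy
  exact Polynomial.toLaurent_injective hxy

/-- For k ≤ p i, the generator z^(-k) b i is the polynomial multiple z^(p i - k) of z^(-p i) b i. -/
theorem IsAdapted.span_tm {F : CompleteFiltration V} {ι : Type*} {b : Module.Basis ι ℂ V}
    {p : ι → ℤ} (h : F.IsAdapted b p) :
    Submodule.span ℂ[X] (Set.range fun i => tm (LaurentPolynomial.T (-p i)) (b i)) = F.rees := by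
  refine le_antisymm ?_ ?_
  · rw [Submodule.span_le]
    rintro _ ⟨i, rfl⟩
    exact F.tm_T_mem_rees (h.mem i) le_rfl
  · refine Submodule.span_le.2 ?_
    rintro _ ⟨k, v, hv, rfl⟩
    rw [h k] at hv
    induction hv using Submodule.span_induction with
    | mem x hx =>
      obtain ⟨i, hi, rfl⟩ := hx
      obtain ⟨n, hn⟩ := Int.eq_ofNat_of_zero_le (sub_nonneg.2 (show k ≤ p i from hi))
      have : tm (LaurentPolynomial.T (-k)) (b i) =
          (Polynomial.X ^ n : ℂ[X]) • tm (LaurentPolynomial.T (-p i)) (b i) := by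
        rw [X_pow_smul, smul_tm, ← LaurentPolynomial.T_add]
        congr 2
        omega
      rw [this]
      exact Submodule.smul_mem _ _ (Submodule.subset_span ⟨i, rfl⟩)
    | zero => rw [tm_zero]; exact Submodule.zero_mem _
    | add x y _ _ hx hy => rw [tm_add]; exact Submodule.add_mem _ hx hy
    | smul c x _ hx => rw [tm_smul, ← C_smul]; exact Submodule.smul_mem _ _ hx

/-- The frame `z ^ (-p i) * b i` of the Rees module attached to an adapted basis. -/
def IsAdapted.reesBasis {F : CompleteFiltration V} {ι : Type*} {b : Module.Basis ι ℂ V}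
    {p : ι → ℤ} (h : F.IsAdapted b p) : Module.Basis ι ℂ[X] F.rees :=
  (Module.Basis.span (linearIndependent_tm b p)).map (LinearEquiv.ofEq _ _ h.span_tm)

theorem IsAdapted.coe_reesBasis {F : CompleteFiltration V} {ι : Type*} {b : Module.Basis ι ℂ V}
    {p : ι → ℤ} (h : F.IsAdapted b p) (i : ι) :
    (h.reesBasis i : PuncturedSections V) = tm (LaurentPolynomial.T (-p i)) (b i) := by
  rw [reesBasis, Module.Basis.map_apply, LinearEquiv.coe_ofEq_apply, Module.Basis.span_apply]

theorem reesTrivialization_glue [Module.Finite ℂ V] (F G : CompleteFiltration V)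
    (x : ℂ[T;T⁻¹] ⊗[ℂ[X]] F.rees) :
    G.reesTrivialization ((reesSimpson F G).glue x) = swap V (F.reesTrivialization x) :=
  G.reesTrivialization.apply_symm_apply _

/-- The swap turns z^(-p j) b j into T^(p j) b j. After b j is expanded in the basis `c`, each c i
is T^(q i) times the frame vector T^(-q i) c i. -/
theorem transition_reesSimpson [Module.Finite ℂ V] {F G : CompleteFiltration V} {m n : ℕ}
    {b : Module.Basis (Fin m) ℂ V} {c : Module.Basis (Fin n) ℂ V} {p : Fin m → ℤ} {q : Fin n → ℤ}
    (hF : F.IsAdapted b p) (hG : G.IsAdapted c q) (i : Fin n) (j : Fin m) :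
    (reesSimpson F G).transition hF.reesBasis hG.reesBasis i j =
      LaurentPolynomial.T (q i) * (LaurentPolynomial.T (p j) *
        LaurentPolynomial.C (c.toMatrix b i j)) := by
  have key : (reesSimpson F G).glue (1 ⊗ₜ[ℂ[X]] hF.reesBasis j) =
      ∑ i, (LaurentPolynomial.T (q i) * (LaurentPolynomial.T (p j) *
        LaurentPolynomial.C (c.toMatrix b i j))) • ((1 : ℂ[T;T⁻¹]) ⊗ₜ[ℂ[X]] hG.reesBasis i) := by
    apply G.reesTrivialization.injective
    refine ((reesTrivialization_glue F G _).trans (congrArg (swap V)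
      (F.reesTrivialization_tmul 1 (hF.reesBasis j)))).trans ?_
    rw [map_sum, one_smul, hF.coe_reesBasis, swap_tm,
      LaurentPolynomial.invert_T, neg_neg]
    conv_lhs => rw [← c.sum_toMatrix_smul_self b j]
    rw [show tm (LaurentPolynomial.T (p j)) (∑ i, c.toMatrix b i j • c i) =
      ∑ i, tm (LaurentPolynomial.T (p j)) (c.toMatrix b i j • c i) from
        TensorProduct.tmul_sum _ _ _]
    refine Finset.sum_congr rfl fun i _ => ?_
    rw [LinearEquiv.map_smul, reesTrivialization_tmul, one_smul, hG.coe_reesBasis, tm_smul, smul_tm,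
      smul_tm]
    congr 1
    rw [mul_comm _ (LaurentPolynomial.T (-q i)), ← mul_assoc, ← LaurentPolynomial.T_add,
      neg_add_cancel, LaurentPolynomial.T_zero, one_mul, mul_comm]
  have h := congrArg (fun x => (hG.reesBasis.baseChange ℂ[T;T⁻¹]).repr x i) key
  refine Eq.trans (b := (hG.reesBasis.baseChange ℂ[T;T⁻¹]).repr
    ((reesSimpson F G).glue (1 ⊗ₜ[ℂ[X]] hF.reesBasis j)) i) rfl (h.trans ?_)
  simp only [← Module.Basis.baseChange_apply, map_sum, map_smul, Module.Basis.repr_self]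
  simp [Finsupp.single_apply]

/-- The monomials factor out of the rows and columns of the determinant, leaving the nonzero
constant determinant of a change of basis. -/
theorem hasDegree_reesSimpson [Module.Finite ℂ V] {F G : CompleteFiltration V} {n : ℕ}
    {b c : Module.Basis (Fin n) ℂ V} {p q : Fin n → ℤ}
    (hF : F.IsAdapted b p) (hG : G.IsAdapted c q) :
    (reesSimpson F G).HasDegree (∑ i, p i + ∑ i, q i) := by
  have hT : ∀ p : Fin n → ℤ, ∏ i, (LaurentPolynomial.T (p i) : ℂ[T;T⁻¹]) =
      LaurentPolynomial.T (∑ i, p i) := fun p => by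
    induction (Finset.univ : Finset (Fin n)) using Finset.cons_induction with
    | empty => simp
    | cons a s ha ih => rw [Finset.prod_cons, Finset.sum_cons, LaurentPolynomial.T_add, ih]
  refine ⟨n, hF.reesBasis, hG.reesBasis, (c.toMatrix b).det, ?_, ?_⟩
  · rw [← Module.Basis.det_apply]
    exact (c.isUnit_det b).ne_zero
  · have : (reesSimpson F G).transition hF.reesBasis hG.reesBasis =
        Matrix.of fun i j => LaurentPolynomial.T (q i) * (Matrix.of fun i j =>
          LaurentPolynomial.T (p j) * ((c.toMatrix b).map LaurentPolynomial.C) i j) i j := by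
      ext1 i j
      rw [transition_reesSimpson]
      rfl
    rw [this, Matrix.det_mul_column, Matrix.det_mul_row, hT, hT, LaurentPolynomial.T_add,
      RingHom.map_det]
    rw [RingHom.mapMatrix_apply]
    ring

theorem rank_reesSimpson [Module.Finite ℂ V] (F G : CompleteFiltration V) :
    (reesSimpson F G).rank = Module.finrank ℂ V := by
  obtain ⟨n, b, p, h⟩ := F.exists_isAdapted
  rw [P1Bundle.rank, Module.finrank_eq_card_basis b]
  exact Module.finrank_eq_card_basis h.reesBasis

end CompleteFiltration

theorem P1Bundle.HasDegree.degree_eq {E : P1Bundle.{u}} {d : ℤ} (h : E.HasDegree d) :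
    E.degree = d :=
  E.hasDegree_degree.unique h

/-! ### Functoriality for bifiltered maps -/

namespace PuncturedSections

variable {W V : Type u} [AddCommGroup W] [Module ℂ W] [AddCommGroup V] [Module ℂ V]

/-- The map of sections of trivial bundles induced by a linear map of the fibres. -/
def map (f : W →ₗ[ℂ] V) : PuncturedSections W →ₗ[ℂ[T;T⁻¹]] PuncturedSections V :=
  f.baseChange ℂ[T;T⁻¹]

theorem map_injective {f : W →ₗ[ℂ] V} (hf : Function.Injective f) :
    Function.Injective (map f) :=
  Module.Flat.lTensor_preserves_injective_linearMap f hf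

theorem swap_map (f : W →ₗ[ℂ] V) (x : PuncturedSections W) :
    swap V (map f x) = map f (swap W x) := by
  induction x using PuncturedSections.induction with
  | zero => simp only [map_zero]
  | tm g v => rfl
  | add x y hx hy => simp only [map_add, hx, hy]

end PuncturedSections

namespace CompleteFiltration

open PuncturedSections

variable {W V : Type u} [AddCommGroup W] [Module ℂ W] [AddCommGroup V] [Module ℂ V]

/-- The map of Rees modules induced by a filtered linear map. -/
def reesMap {F' : CompleteFiltration W} {F : CompleteFiltration V} (f : W →ₗ[ℂ] V)
    (hf : ∀ k, F'.F k ≤ (F.F k).comap f) : F'.rees →ₗ[ℂ[X]] F.rees :=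
  ((map f).restrictScalars ℂ[X]).restrict (p := F'.rees) (q := F.rees) <| by
    change F'.rees ≤ F.rees.comap ((map f).restrictScalars ℂ[X])
    refine Submodule.span_le.2 ?_
    rintro _ ⟨k, v, hv, rfl⟩
    exact Submodule.subset_span ⟨k, f v, hf k hv, rfl⟩

theorem coe_reesMap {F' : CompleteFiltration W} {F : CompleteFiltration V} (f : W →ₗ[ℂ] V)
    (hf : ∀ k, F'.F k ≤ (F.F k).comap f) (x : F'.rees) :
    (reesMap f hf x : PuncturedSections V) = map f x := rfl

theorem reesMap_injective {F' : CompleteFiltration W} {F : CompleteFiltration V} {f : W →ₗ[ℂ] V}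
    (hf : ∀ k, F'.F k ≤ (F.F k).comap f) (hinj : Function.Injective f) :
    Function.Injective (reesMap f hf) := fun _ _ h =>
  Subtype.ext (map_injective hinj (congrArg Subtype.val h))

theorem reesTrivialization_reesMap {F' : CompleteFiltration W} {F : CompleteFiltration V}
    (f : W →ₗ[ℂ] V) (hf : ∀ k, F'.F k ≤ (F.F k).comap f) (x : ℂ[T;T⁻¹] ⊗[ℂ[X]] F'.rees) :
    F.reesTrivialization ((reesMap f hf).baseChange ℂ[T;T⁻¹] x) =
      map f (F'.reesTrivialization x) := by
  induction x with
  | zero => simp only [map_zero]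
  | tmul g s =>
    rw [LinearMap.baseChange_tmul, reesTrivialization_tmul, reesTrivialization_tmul, coe_reesMap,
      map_smul]
  | add x y hx hy => simp only [map_add, hx, hy]

/-- The morphism of Rees–Simpson bundles induced by a bifiltered linear map. -/
def reesSimpsonHom [Module.Finite ℂ W] [Module.Finite ℂ V] {F' G' : CompleteFiltration W}
    {F G : CompleteFiltration V} (f : W →ₗ[ℂ] V) (hF : ∀ k, F'.F k ≤ (F.F k).comap f)
    (hG : ∀ k, G'.F k ≤ (G.F k).comap f) :
    P1Bundle.Hom (reesSimpson F' G') (reesSimpson F G) where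
  φ₀ := reesMap f hF
  φ₁ := reesMap f hG
  comm x := by
    apply G.reesTrivialization.injective
    refine (reesTrivialization_glue F G _).trans ?_
    refine Eq.trans ?_ (reesTrivialization_reesMap f hG ((reesSimpson F' G').glue x)).symm
    refine Eq.trans ?_ (congrArg (map f) (reesTrivialization_glue F' G' x).symm)
    rw [← swap_map]
    exact congrArg (swap V) (reesTrivialization_reesMap f hF x)

/-! ### From semistability to purity -/

/-- The filtration of `V` with a single jump in degree `k`. -/
def single (V : Type u) [AddCommGroup V] [Module ℂ V] (k : ℤ) : CompleteFiltration V where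
  F j := if j ≤ k then ⊤ else ⊥
  antitone i j hij := by
    dsimp only
    split_ifs
    · exact le_rfl
    · omega
    · exact bot_le
    · exact le_rfl
  exists_eq_top := ⟨k, if_pos le_rfl⟩
  exists_eq_bot := ⟨k + 1, if_neg (by omega)⟩

theorem isAdapted_single (k : ℤ) {ι : Type*} (b : Module.Basis ι ℂ V) :
    (single V k).IsAdapted b fun _ => k := by
  intro j
  by_cases h : j ≤ k
  · simp [single, h]
  · simp [single, h]

/-- A nonzero common vector spans a line. Filtered with single jumps at k and m, this line gives a
rank one subsheaf of degree k + m > w. -/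
theorem disjoint_of_isSemistableOfSlope [Module.Finite ℂ V] {F G : CompleteFiltration V} {w : ℤ}
    (h : (reesSimpson F G).IsSemistableOfSlope w) {k m : ℤ} (hkm : w < k + m) :
    Disjoint (F.F k) (G.F m) := by
  rw [Submodule.disjoint_def]
  intro v hv hv'
  by_contra hne
  let W := Submodule.span ℂ {v}
  have hW : Module.finrank ℂ W = 1 := finrank_span_singleton hne
  have hle : ∀ (F : CompleteFiltration V) (k : ℤ), v ∈ F.F k →
      ∀ j, (single W k).F j ≤ (F.F j).comap W.subtype := by
    intro F k hv j
    by_cases hj : j ≤ k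
    · rintro x -
      exact (Submodule.span_singleton_le_iff_mem _ _).2 (F.antitone hj hv) x.2
    · simp [single, hj]
  let b : Module.Basis (Fin 1) ℂ W := (Module.finBasis ℂ W).reindex (finCongr hW)
  have hdeg := (hasDegree_reesSimpson (isAdapted_single k b) (isAdapted_single m b)).degree_eq
  have hrank : (reesSimpson (single W k) (single W m)).rank = 1 := by rw [rank_reesSimpson, hW]
  have hrank' : (reesSimpson F G).rank ≠ 0 := by
    rw [rank_reesSimpson]
    have : Nontrivial V := ⟨v, 0, hne⟩
    exact Module.finrank_pos.ne'
  have hs := h.1 _ (reesSimpsonHom W.subtype (hle F k hv) (hle G m hv'))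
    ⟨reesMap_injective (hle F k hv) W.injective_subtype,
      reesMap_injective (hle G m hv') W.injective_subtype⟩
    (by rw [hrank]; exact one_ne_zero)
  rw [h.2 hrank', P1Bundle.slope, hdeg, hrank] at hs
  simp only [Finset.univ_unique, Finset.sum_singleton, Nat.cast_one, div_one, Int.cast_le] at hs
  omega

theorem isPureOfWeight_of_isSemistableOfSlope [Module.Finite ℂ V] {F G : CompleteFiltration V}
    {w : ℤ} (h : (reesSimpson F G).IsSemistableOfSlope w) : F.IsPureOfWeight G w := by
  have hdisj : ∀ k m, w < k + m → Disjoint (F.F k) (G.F m) :=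
    fun _ _ => disjoint_of_isSemistableOfSlope h
  obtain ⟨n, b, p, hF⟩ := F.exists_isAdapted
  obtain ⟨n', c, q, hG⟩ := G.exists_isAdapted
  obtain rfl : n = n' := by
    simpa using (Module.finrank_eq_card_basis b).symm.trans (Module.finrank_eq_card_basis c)
  refine isPureOfWeight_of_opposed hdisj (finrank_add_finrank hF hG hdisj ?_)
  have hr : (reesSimpson F G).rank = n := by
    rw [rank_reesSimpson, Module.finrank_eq_card_basis b, Fintype.card_fin]
  -- For the zero bundle the slope condition says nothing, but the required sum is then 0 = 0.
  rcases Nat.eq_zero_or_pos n with rfl | hn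
  · simp
  have hs := h.2 (by omega)
  rw [P1Bundle.slope, (hasDegree_reesSimpson hF hG).degree_eq, hr,
    div_eq_iff (by positivity)] at hs
  rw [Fintype.card_fin, mul_comm]
  exact_mod_cast hs

end CompleteFiltration

/-! ### Subsheaves of a sum of copies of 𝒪(w) -/

/-- A matrix over a domain with linearly independent columns has a nonzero maximal minor. -/
theorem Matrix.exists_det_submatrix_ne_zero {R : Type*} [CommRing R] [IsDomain R] {m : Type*}
    [Fintype m] {r : ℕ} (P : Matrix m (Fin r) R) (hP : LinearIndependent R P.col) :
    ∃ f : Fin r → m, (P.submatrix f id).det ≠ 0 := by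
  let K := FractionRing R
  have h1 : LinearIndependent K (P.map (algebraMap R K)).transpose.row := by
    have h2 : LinearIndependent R (((Algebra.linearMap R K).compLeft m) ∘ P.col) := by
      refine hP.map' _ (LinearMap.ker_eq_bot.2 fun x y h => funext fun i => ?_)
      exact IsFractionRing.injective R K (congrFun h i)
    exact (LinearIndependent.iff_fractionRing R K).1 h2
  have h3 := h1.rank_matrix
  rw [Matrix.rank_transpose, Matrix.rank_eq_finrank_span_row, Fintype.card_fin] at h3
  -- Over the fraction field row rank equals column rank r, so r independent rows can be selected.
  obtain ⟨f, hf, -, hli⟩ :=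
    Submodule.exists_fun_fin_finrank_span_eq K (Set.range (P.map (algebraMap R K)).row)
  choose g hg using hf
  refine ⟨fun i => g (finCongr h3.symm i), fun h => ?_⟩
  have h4 : LinearIndependent K
      ((P.map (algebraMap R K)).submatrix (fun i => g (finCongr h3.symm i)) id).row := by
    have := hli.comp _ (finCongr h3.symm).injective
    rw [← funext hg] at this
    exact this
  have h5 := (Matrix.isUnit_iff_isUnit_det _).1 (Matrix.linearIndependent_rows_iff_isUnit.1 h4)
  refine h5.ne_zero ?_
  rw [Matrix.submatrix_map, ← RingHom.mapMatrix_apply, ← RingHom.map_det, h, map_zero]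

/-- The left side has only exponents at least m > 0, the right side only exponents at most 0. After
multiplication by T^(deg p), the reverse of p, of degree at most deg p, would be divisible by X^(m +
deg p). -/
theorem LaurentPolynomial.eq_zero_of_mul_T_eq_invert {p q : ℂ[X]} {m : ℕ} (hm : 0 < m)
    (h : Polynomial.toLaurent q * T m = invert (Polynomial.toLaurent p)) : p = 0 := by
  by_contra hp
  have h1 : p.reverse = q * Polynomial.X ^ (m + p.natDegree) := by
    apply Polynomial.toLaurent_injective
    rw [toLaurent_reverse, ← h, map_mul, Polynomial.toLaurent_X_pow, Nat.cast_add, T_add, mul_assoc]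
  have h2 : p.reverse ≠ 0 := mt Polynomial.reverse_eq_zero.1 hp
  have h3 := Polynomial.natDegree_le_of_dvd (Dvd.intro_left _ h1.symm) h2
  rw [Polynomial.natDegree_X_pow] at h3
  have := p.reverse_natDegree_le
  omega

namespace P1Bundle

/-- In frames, a morphism of bundles intertwines the transition matrices. -/
theorem Hom.transition_mul {E F : P1Bundle.{u}} (φ : Hom F E) {n n' r r' : ℕ}
    (a₀ : Module.Basis (Fin r) ℂ[X] F.M₀) (a₁ : Module.Basis (Fin r') ℂ[X] F.M₁)
    (b₀ : Module.Basis (Fin n) ℂ[X] E.M₀) (b₁ : Module.Basis (Fin n') ℂ[X] E.M₁) :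
    E.transition b₀ b₁ *
        ((LinearMap.toMatrix a₀ b₀ φ.φ₀).map Polynomial.toLaurent).map coordInv =
      (LinearMap.toMatrix a₁ b₁ φ.φ₁).map Polynomial.toLaurent * F.transition a₀ a₁ := by
  have hbc : ∀ {M N : Type u} [AddCommGroup M] [Module ℂ[X] M] [AddCommGroup N] [Module ℂ[X] N]
      {s t : ℕ} (a : Module.Basis (Fin s) ℂ[X] M) (b : Module.Basis (Fin t) ℂ[X] N)
      (f : M →ₗ[ℂ[X]] N) (j : Fin s), f.baseChange ℂ[T;T⁻¹] (1 ⊗ₜ a j) =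
        ∑ i, Polynomial.toLaurent (LinearMap.toMatrix a b f i j) • ((1 : ℂ[T;T⁻¹]) ⊗ₜ[ℂ[X]] b i) := by
    intro M N _ _ _ _ s t a b f j
    rw [LinearMap.baseChange_tmul]
    conv_lhs => rw [← b.sum_repr (f (a j)), TensorProduct.tmul_sum]
    refine Finset.sum_congr rfl fun i _ => ?_
    rw [TensorProduct.tmul_smul, ← LaurentPolynomial.algebraMap_eq_toLaurent, algebraMap_smul,
      LinearMap.toMatrix_apply]
  ext1 l j
  have h := congrArg (fun x => (b₁.baseChange ℂ[T;T⁻¹]).repr x l) (φ.comm (1 ⊗ₜ a₀ j))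
  simp only [hbc a₀ b₀, F.glue_basis a₀ a₁, map_sum, LinearEquiv.map_smulₛₗ, map_smul,
    E.glue_basis b₀ b₁, hbc a₁ b₁] at h
  simp only [← Module.Basis.baseChange_apply, Module.Basis.repr_self,
    Finsupp.coe_finsetSum, Finset.sum_apply, Finsupp.smul_apply, smul_eq_mul,
    Finsupp.single_apply, mul_ite, mul_one, mul_zero, Finset.sum_ite_eq', Finset.mem_univ,
    if_true] at h
  simp only [Matrix.mul_apply, Matrix.map_apply]
  rw [Finset.sum_congr rfl fun i _ => mul_comm _ _, h]
  exact Finset.sum_congr rfl fun i _ => mul_comm _ _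

theorem exists_basis_pair (E : P1Bundle.{u}) {d : ℤ} (h : E.HasDegree d) :
    ∃ (b₀ : Module.Basis (Fin E.rank) ℂ[X] E.M₀) (b₁ : Module.Basis (Fin E.rank) ℂ[X] E.M₁) (c : ℂ),
      (E.transition b₀ b₁).det = LaurentPolynomial.C c * LaurentPolynomial.T d := by
  obtain ⟨n, b₀, b₁, c, -, h⟩ := h
  obtain rfl : E.rank = n := by rw [rank, Module.finrank_eq_card_basis b₀, Fintype.card_fin]
  exact ⟨b₀, b₁, c, h⟩

/-- A subsheaf of a bundle isomorphic to a sum of copies of `𝒪(w)` has slope at most `w`. -/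
theorem degree_le_of_transition_eq_smul_one {E F : P1Bundle.{u}} {n : ℕ}
    {b₀ : Module.Basis (Fin n) ℂ[X] E.M₀} {b₁ : Module.Basis (Fin n) ℂ[X] E.M₁} {w : ℤ}
    (h : E.transition b₀ b₁ = (LaurentPolynomial.T w : ℂ[T;T⁻¹]) • 1)
    (φ : Hom F E) (hφ : Function.Injective φ.φ₀) : F.degree ≤ F.rank * w := by
  classical
  obtain ⟨a₀, a₁, c, hd⟩ := F.exists_basis_pair F.hasDegree_degree
  set P := LinearMap.toMatrix a₀ b₀ φ.φ₀
  set Q := LinearMap.toMatrix a₁ b₁ φ.φ₁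
  have hP : LinearIndependent ℂ[X] P.col := by
    have h1 := (a₀.linearIndependent.map' φ.φ₀ (LinearMap.ker_eq_bot.2 hφ)).map'
      b₀.equivFun.toLinearMap b₀.equivFun.ker
    have h2 : P.col = b₀.equivFun.toLinearMap ∘ φ.φ₀ ∘ a₀ := by
      funext j i
      exact LinearMap.toMatrix_apply _ _ _ _ _
    rw [h2]
    exact h1
  obtain ⟨f, hf⟩ := P.exists_det_submatrix_ne_zero hP
  have key := φ.transition_mul a₀ a₁ b₀ b₁
  rw [h, Matrix.smul_mul, Matrix.one_mul] at key
  -- As the transition matrix of E is scalar, choosing the rows `f` of P on the left chooses the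
  -- same rows of Q on the right, and both sides become square.
  have key' : (LaurentPolynomial.T w : ℂ[T;T⁻¹]) •
      ((P.submatrix f id).map Polynomial.toLaurent).map coordInv =
        (Q.submatrix f id).map Polynomial.toLaurent * F.transition a₀ a₁ :=
    congrArg (fun M => M.submatrix f id) key
  have hdet := congrArg Matrix.det key'
  simp only [Matrix.det_smul, Matrix.det_mul, ← RingHom.mapMatrix_apply, ← RingHom.map_det, hd,
    LaurentPolynomial.T_pow, Fintype.card_fin, coordInv_apply] at hdet
  by_contra! hlt
  obtain ⟨m, hm⟩ := Int.eq_ofNat_of_zero_le (sub_nonneg.2 hlt.le)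
  -- Here m = deg F - rank F · w > 0, and T^(rank F · w) has been moved to the other side of the
  -- determinant identity.
  refine hf (LaurentPolynomial.eq_zero_of_mul_T_eq_invert (q := (Q.submatrix f id).det *
    Polynomial.C c) (m := m) (by omega) ?_)
  rw [map_mul, Polynomial.toLaurent_C, ← hm, sub_eq_add_neg, LaurentPolynomial.T_add, ← mul_assoc,
    mul_assoc _ (LaurentPolynomial.C c), ← hdet, mul_right_comm, ← LaurentPolynomial.T_add,
    add_neg_cancel, LaurentPolynomial.T_zero, one_mul]

end P1Bundle

/-! ### From purity to semistability -/

namespace CompleteFiltration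

theorem IsPureOfWeight.isSemistableOfSlope {V : Type u} [AddCommGroup V] [Module ℂ V]
    [Module.Finite ℂ V] {F G : CompleteFiltration V} {w : ℤ} (h : F.IsPureOfWeight G w) :
    (reesSimpson F G).IsSemistableOfSlope w := by
  obtain ⟨n, b, p, hF, hG⟩ := h.exists_isAdapted
  have htr : (reesSimpson F G).transition hF.reesBasis hG.reesBasis =
      (LaurentPolynomial.T w : ℂ[T;T⁻¹]) • 1 := by
    ext1 i j
    rw [transition_reesSimpson, Module.Basis.toMatrix_self, Matrix.smul_apply, smul_eq_mul,
      Matrix.one_apply, Matrix.one_apply]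
    split_ifs with hij
    · rw [hij, map_one, mul_one, mul_one, ← LaurentPolynomial.T_add, sub_add_cancel]
    · rw [map_zero, mul_zero, mul_zero, mul_zero]
  have hslope : (reesSimpson F G).rank ≠ 0 → (reesSimpson F G).slope = w := by
    intro h0
    have hr : (reesSimpson F G).rank = n := by
      rw [rank_reesSimpson, Module.finrank_eq_card_basis b, Fintype.card_fin]
    rw [P1Bundle.slope, div_eq_iff (by exact_mod_cast h0),
      (hasDegree_reesSimpson hF hG).degree_eq, hr, ← Finset.sum_add_distrib]
    simp [mul_comm]
  refine ⟨fun E φ hφ hE => ?_, hslope⟩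
  -- A zero bundle has no subsheaf of nonzero rank, so the slope is indeed w here.
  have h0 : (reesSimpson F G).rank ≠ 0 := fun h0 => hE <| by
    have := LinearMap.finrank_le_finrank_of_injective hφ.1
    exact Nat.le_zero.1 (this.trans h0.le)
  rw [hslope h0, P1Bundle.slope, div_le_iff₀ (by exact_mod_cast Nat.pos_of_ne_zero hE), mul_comm]
  exact_mod_cast P1Bundle.degree_le_of_transition_eq_smul_one htr φ hφ.1

end CompleteFiltration

end

/-- `r` is the real structure of `V` (a conjugate-linear map) with respect to which the two
filtrations are conjugate. -/
theorem mainTheorem6 {V : Type*} [AddCommGroup V] [Module ℂ V] [Module.Finite ℂ V]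
    (r : V →ₛₗ[starRingEnd ℂ] V) (F Fbar : CompleteFiltration V)
    (hF : ∀ k : ℤ, Fbar.F k = (F.F k).map r) (w : ℤ) :
    CompleteFiltration.IsPureOfWeight F Fbar w ↔
      (CompleteFiltration.reesSimpson F Fbar).IsSemistableOfSlope w := by
  exact ⟨fun h => h.isSemistableOfSlope,
    CompleteFiltration.isPureOfWeight_of_isSemistableOfSlope⟩
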